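/- Let $q$ be a complex number with $|q|<1$. Write $(a;q)_n=\prod_{k=0}^{n-1}(1-aq^k)$ for integers $n\ge 0$, $(a;q)_\infty=\prod_{k\ge 0}(1-aq^k)$ and $(a_1,\dots,a_m;q)_\infty=\prod_{k=1}^m (a_k;q)_\infty$. Then the following six double series, over all integers $i,j\ge 0$, converge absolutely and \begin{align*} \sum_{i,j\ge0}\frac{q^{\frac{3}{2}i^2-2ij+2j^2+\frac{1}{2}i-j}}{(q;q)_{2i}(q;q)_{2j}}&=\frac{1}{(q;q^2)_\infty^2(q^{2},q^{4},q^{10},q^{12};q^{14})_\infty},\\ \sum_{i,j\ge0}\frac{q^{\frac{3}{2}i^2-2ij+2j^2-\frac{1}{2}i+j}}{(q;q)_{2i}(q;q)_{2j+1}}&=\frac{1}{(q;q^2)_\infty^2(q^{2},q^{4},q^{10},q^{12};q^{14})_\infty},\\ \sum_{i,j\ge0}\frac{q^{\frac{3}{2}i^2-2ij+2j^2+\frac{3}{2}i-j}}{(q;q)_{2i+1}(q;q)_{2j}}&=\frac{1}{(q;q^2)_\infty^2(q^{2},q^{6},q^{8},q^{12};q^{14})_\infty},\\ \sum_{i,j\ge0}\frac{q^{\frac{3}{2}i^2-2ij+2j^2+\frac{1}{2}i+j}}{(q;q)_{2i+1}(q;q)_{2j+1}}&=\frac{1}{(q;q^2)_\infty^2(q^{2},q^{6},q^{8},q^{12};q^{14})_\infty},\\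 \sum_{i,j\ge0}\frac{q^{\frac{3}{2}i^2-2ij+2j^2+\frac{5}{2}i-j}}{(q;q)_{2i+1}(q;q)_{2j}}&=\frac{1}{(q;q^2)_\infty^2(q^{4},q^{6},q^{8},q^{10};q^{14})_\infty},\\ \sum_{i,j\ge0}\frac{q^{\frac{3}{2}i^2-2ij+2j^2+\frac{3}{2}i+j}}{(q;q)_{2i+1}(q;q)_{2j+1}}&=\frac{1}{(q;q^2)_\infty^2(q^{4},q^{6},q^{8},q^{10};q^{14})_\infty}. \end{align*} -/

import Mathlib

namespace QSeries

noncomputable section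

/-- The finite product `(a; q)_n = (1 - a)(1 - a q) ⋯ (1 - a q ^ (n - 1))`. -/
def qPoch (a q : ℂ) (n : ℕ) : ℂ := ∏ k ∈ Finset.range n, (1 - a * q ^ k)

/-- The infinite product `(a; q)_∞ = ∏_{k ≥ 0} (1 - a q ^ k)`, meant for `‖q‖ < 1`. -/
def qPochInf (a q : ℂ) : ℂ := ∏' k : ℕ, (1 - a * q ^ k)

/-- The compressed notation `(a₁, …, a_m; q)_∞ = (a₁; q)_∞ ⋯ (a_m; q)_∞`. -/
def qPochInfs (as : List ℂ) (q : ℂ) : ℂ := (as.map fun a => qPochInf a q).prod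

/-- For `‖q‖ < 1` the product that defines `(a; q)_∞` converges. -/
theorem multipliable_qPochInf (a : ℂ) {q : ℂ} (hq : ‖q‖ < 1) :
    Multipliable fun k : ℕ => 1 - a * q ^ k := by
  have h : Summable fun k : ℕ => ‖-(a * q ^ k)‖ := by
    simpa [norm_mul, norm_pow] using
      (summable_geometric_of_lt_one (norm_nonneg q) hq).mul_left ‖a‖
  simpa [sub_eq_add_neg] using multipliable_one_add_of_summable h

end

end QSeries

/-!
The inner sum over `j` is the even or the odd part of Euler's series
`∑ q ^ (J (J - 1) / 2) z ^ J / (q; q)_J = (-z; q)_∞` at `z = q ^ (-i)`. At `z = -q ^ (-i)` the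
product vanishes, so both parts are equal to `(-q ^ (-i); q)_∞ / 2`, which is
`q ^ (-i (i + 1) / 2) (-q; q)_i (-q; q)_∞` (`hasSum_inner`). This explains why the identities come
in pairs, and reduces each double series to `(-q; q)_∞` times one of
`∑ q ^ (i ^ 2 + s i) (-q; q)_i / (q; q)_{2 i + δ}` with `(s, δ) = (0, 0), (1, 1), (2, 1)`: the
left-hand sides of Rogers' three identities modulo 14.

Those follow from Bailey's method. The quotient `(-q; q)_n / (q; q)_{2 n + δ}` is expanded as
`∑_r (-1) ^ r q ^ (3 r ^ 2 + r) / ((q; q)_{n - 2 r} (q; q)_{n + s + 2 r})` over all integers `r`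
(`altSum_self`, `altSum_add_one`, `altSum_add_two`). These expansions use only the `q`-Pascal rules,
a reflection and a shift of `r`, which also make one of the sums that arise antisymmetric and hence
zero. After exchanging the order of summation the sum over `n` is Cauchy's Durfee sum
(`hasSum_durfee`), leaving the theta series `∑_r (-1) ^ r q ^ (7 r ^ 2 + (2 s + 1) r)` divided by
`(q; q)_∞` (`hasSum_bailey`). The Jacobi triple product (`hasSum_jacobi`), again a consequence of
Euler's series and the Durfee sum, turns it into a product. Finally `(q; q)_∞` is sorted by residues
and `(q; q²)_∞ (-q; q)_∞ = 1`.

To let `r` range over all of `ℤ` freely, `1 / (q; q)_n` is extended by zero to negative `n`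
(`invPoch`). Powers of `q` with integer exponents require `q ≠ 0`; for `q = 0` only the term
`i = j = 0` survives.
-/

/-! ### Shifted factorials -/

namespace QSeries

open Filter Topology

lemma qPoch_succ (a q : ℂ) (n : ℕ) : qPoch a q (n + 1) = qPoch a q n * (1 - a * q ^ n) := by
  simp [qPoch, Finset.prod_range_succ]

lemma one_sub_mul_pow_ne_zero {a q : ℂ} (ha : ‖a‖ < 1) (hq : ‖q‖ < 1) (k : ℕ) :
    1 - a * q ^ k ≠ 0 := by
  intro h
  have h1 : ‖a * q ^ k‖ < 1 := by
    rw [norm_mul, norm_pow]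
    exact mul_lt_one_of_nonneg_of_lt_one_left (norm_nonneg a) ha
      (pow_le_one₀ (norm_nonneg q) hq.le)
  rw [← sub_eq_zero.mp h] at h1
  simp at h1

lemma qPoch_ne_zero {a q : ℂ} (ha : ‖a‖ < 1) (hq : ‖q‖ < 1) (n : ℕ) : qPoch a q n ≠ 0 :=
  Finset.prod_ne_zero_iff.mpr fun k _ => one_sub_mul_pow_ne_zero ha hq k

lemma tendsto_qPoch (a : ℂ) {q : ℂ} (hq : ‖q‖ < 1) :
    Tendsto (qPoch a q) atTop (𝓝 (qPochInf a q)) :=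
  (multipliable_qPochInf a hq).hasProd.tendsto_prod_nat

lemma qPochInf_ne_zero {a q : ℂ} (ha : ‖a‖ < 1) (hq : ‖q‖ < 1) : qPochInf a q ≠ 0 := by
  have h : Summable fun k : ℕ => ‖-(a * q ^ k)‖ := by
    simpa [norm_mul, norm_pow] using
      (summable_geometric_of_lt_one (norm_nonneg q) hq).mul_left ‖a‖
  have := tprod_one_add_ne_zero_of_summable (f := fun k : ℕ => -(a * q ^ k))
    (fun k => by simpa [sub_eq_add_neg] using one_sub_mul_pow_ne_zero ha hq k) h
  simpa [qPochInf, sub_eq_add_neg] using this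

lemma qPochInf_eq_one_sub_mul (a : ℂ) {q : ℂ} (hq : ‖q‖ < 1) :
    qPochInf a q = (1 - a) * qPochInf (a * q) q := by
  have h' : HasProd (fun k : ℕ => 1 - a * q ^ (k + 1)) (qPochInf (a * q) q) := by
    convert (multipliable_qPochInf (a * q) hq).hasProd using 3
    · ring
    · rfl
  have h := h'.zero_mul (f := fun k : ℕ => 1 - a * q ^ k)
  simpa [qPochInf] using h.tprod_eq

/-- Sorting the factors of `(a; q)_∞` by the residue of their index modulo `m`. -/
lemma qPochInf_eq_prod_residues (a : ℂ) {q : ℂ} (hq : ‖q‖ < 1) {m : ℕ} (hm : m ≠ 0) :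
    qPochInf a q = ∏ j ∈ Finset.range m, qPochInf (a * q ^ j) (q ^ m) := by
  have hqm : ‖q ^ m‖ < 1 := by
    rw [norm_pow]
    exact pow_lt_one₀ (norm_nonneg q) hq hm
  have hfin : ∀ n, qPoch a q (m * n) = ∏ j ∈ Finset.range m, qPoch (a * q ^ j) (q ^ m) n := by
    intro n
    induction n with
    | zero => simp [qPoch]
    | succ n ih =>
      simp only [qPoch_succ, Finset.prod_mul_distrib, ← ih]
      rw [mul_add, mul_one, qPoch, Finset.prod_range_add, ← qPoch]
      congr 1
      refine Finset.prod_congr rfl fun j _ => ?_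
      ring
  refine tendsto_nhds_unique
    ((tendsto_qPoch a hq).comp (tendsto_id.const_mul_atTop' (Nat.pos_of_ne_zero hm))) ?_
  refine (tendsto_finsetProd (Finset.range m)
    fun j _ => tendsto_qPoch (a * q ^ j) hqm).congr fun n => ?_
  simpa using (hfin n).symm

lemma qPochInf_mul_qPochInf_neg (q : ℂ) (hq : ‖q‖ < 1) :
    qPochInf q (q ^ 2) * qPochInf (-q) q = 1 := by
  have hq2 : ‖q ^ 2‖ < 1 := by
    rw [norm_pow]
    exact pow_lt_one₀ (norm_nonneg q) hq two_ne_zero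
  have h1 : qPochInf q q = qPochInf q (q ^ 2) * qPochInf (q ^ 2) (q ^ 2) := by
    rw [qPochInf_eq_prod_residues q hq two_ne_zero]
    simp [Finset.prod_range_succ, ← pow_two]
  have h2 : qPochInf q q * qPochInf (-q) q = qPochInf (q ^ 2) (q ^ 2) := by
    refine tendsto_nhds_unique ((tendsto_qPoch q hq).mul (tendsto_qPoch (-q) hq)) ?_
    refine (tendsto_qPoch (q ^ 2) hq2).congr fun n => ?_
    simp only [qPoch, ← Finset.prod_mul_distrib]
    refine Finset.prod_congr rfl fun j _ => ?_
    ring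
  have h3 := qPochInf_ne_zero hq2 hq2
  rw [h1] at h2
  apply mul_right_cancel₀ h3
  linear_combination h2

/-- The reciprocal `1 / (q; q)_n`, extended by `0` to negative `n`. -/
noncomputable def invPoch (q : ℂ) (n : ℤ) : ℂ := if 0 ≤ n then (qPoch q q n.toNat)⁻¹ else 0

lemma invPoch_natCast (q : ℂ) (n : ℕ) : invPoch q n = (qPoch q q n)⁻¹ := by simp [invPoch]

lemma invPoch_of_neg (q : ℂ) {n : ℤ} (h : n < 0) : invPoch q n = 0 := by
  simp [invPoch, not_le.mpr h]

lemma invPoch_zero (q : ℂ) : invPoch q 0 = 1 := by simp [invPoch, qPoch]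

/-- With the convention `1 / (q; q)_n = 0` for `n < 0`, the recurrence holds at every integer. -/
lemma invPoch_sub_one {q : ℂ} (hq : ‖q‖ < 1) (n : ℤ) :
    invPoch q (n - 1) = (1 - q ^ n) * invPoch q n := by
  rcases lt_trichotomy n 0 with h | rfl | h
  · rw [invPoch_of_neg q h, invPoch_of_neg q (by omega), mul_zero]
  · simp [invPoch_of_neg]
  · obtain ⟨m, rfl⟩ : ∃ m : ℕ, n = ((m + 1 : ℕ) : ℤ) := ⟨(n - 1).toNat, by omega⟩
    have h1 := qPoch_ne_zero hq hq m
    have h2 := one_sub_mul_pow_ne_zero hq hq m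
    rw [invPoch_natCast, qPoch_succ, show ((m + 1 : ℕ) : ℤ) - 1 = (m : ℤ) by push_cast; ring,
      invPoch_natCast, zpow_natCast, pow_succ']
    field_simp

lemma exists_norm_invPoch_le {q : ℂ} (hq : ‖q‖ < 1) : ∃ M : ℝ, 0 ≤ M ∧ ∀ n, ‖invPoch q n‖ ≤ M := by
  have h := ((tendsto_qPoch q hq).inv₀ (qPochInf_ne_zero hq hq)).norm
  obtain ⟨M, hM⟩ := h.bddAbove_range
  have hM' : ∀ n : ℕ, ‖(qPoch q q n)⁻¹‖ ≤ M := fun n => hM ⟨n, rfl⟩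
  have h0 : 0 ≤ M := (norm_nonneg _).trans (hM' 0)
  refine ⟨M, h0, fun n => ?_⟩
  unfold invPoch
  split_ifs
  · exact hM' _
  · simpa using h0

lemma tendsto_invPoch {q : ℂ} (hq : ‖q‖ < 1) :
    Tendsto (fun n : ℕ => invPoch q n) atTop (𝓝 (qPochInf q q)⁻¹) := by
  simpa only [invPoch_natCast] using (tendsto_qPoch q hq).inv₀ (qPochInf_ne_zero hq hq)

end QSeries

/-! ### Euler's series, Cauchy's Durfee sum and the Jacobi triple product -/

namespace QSeries

open Filter Topology

lemma summable_norm_eulerTerm {q : ℂ} (hq : ‖q‖ < 1) (z : ℂ) :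
    Summable fun a : ℕ => ‖q ^ a.choose 2 * z ^ a * invPoch q a‖ := by
  have hrec : ∀ a : ℕ, (1 - q ^ (a + 1)) *
      (q ^ (a + 1).choose 2 * z ^ (a + 1) * invPoch q ((a + 1 : ℕ) : ℤ)) =
      (q ^ a * z) * (q ^ a.choose 2 * z ^ a * invPoch q a) := by
    intro a
    have h := invPoch_sub_one hq ((a + 1 : ℕ) : ℤ)
    rw [zpow_natCast, show ((a + 1 : ℕ) : ℤ) - 1 = a by push_cast; ring] at h
    rw [h, Nat.choose_succ_succ' a 1, Nat.choose_one_right, pow_add, pow_succ z]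
    ring
  have hpos : 0 < 1 - ‖q‖ := by linarith
  have hlim : Tendsto (fun a : ℕ => ‖q‖ ^ a * ‖z‖) atTop (𝓝 0) := by
    simpa using (tendsto_pow_atTop_nhds_zero_of_lt_one (norm_nonneg q) hq).mul_const ‖z‖
  refine summable_of_ratio_norm_eventually_le (r := 1 / 2) (by norm_num) ?_
  filter_upwards [hlim.eventually_le_const (show (0 : ℝ) < (1 - ‖q‖) / 2 by linarith)] with a ha
  have h := congrArg norm (hrec a)
  rw [norm_mul, norm_mul (q ^ a * z), norm_mul (q ^ a), norm_pow q a] at h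
  have h1 : 1 - ‖q‖ ≤ ‖1 - q ^ (a + 1)‖ := by
    have h2 := norm_sub_norm_le (1 : ℂ) (q ^ (a + 1))
    have h3 : ‖q ^ (a + 1)‖ ≤ ‖q‖ := by
      rw [norm_pow]
      exact pow_le_of_le_one (norm_nonneg q) hq.le (Nat.succ_ne_zero a)
    rw [norm_one] at h2
    linarith
  rw [norm_norm, norm_norm]
  have h4 := mul_le_mul_of_nonneg_right h1
    (norm_nonneg (q ^ (a + 1).choose 2 * z ^ (a + 1) * invPoch q ((a + 1 : ℕ) : ℤ)))
  have h5 := mul_le_mul_of_nonneg_right ha (norm_nonneg (q ^ a.choose 2 * z ^ a * invPoch q a))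
  rw [h] at h4
  refine le_of_mul_le_mul_left ?_ hpos
  linarith

/-- The functional equation `F z = (1 + z) F (q z)` of Euler's series. -/
lemma tsum_eulerTerm_eq {q : ℂ} (hq : ‖q‖ < 1) (z : ℂ) :
    ∑' a : ℕ, q ^ a.choose 2 * z ^ a * invPoch q a =
      (1 + z) * ∑' a : ℕ, q ^ a.choose 2 * (z * q) ^ a * invPoch q a := by
  have h1 := (summable_norm_eulerTerm hq z).of_norm
  have h2 := (summable_norm_eulerTerm hq (z * q)).of_norm
  have h3 : ∑' a : ℕ, (q ^ a.choose 2 * z ^ a * invPoch q a -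
      q ^ a.choose 2 * (z * q) ^ a * invPoch q a) =
      z * ∑' a : ℕ, q ^ a.choose 2 * (z * q) ^ a * invPoch q a := by
    rw [(h1.sub h2).tsum_eq_zero_add, ← tsum_mul_left]
    simp only [Nat.choose_zero_succ, pow_zero, sub_self, zero_add]
    refine tsum_congr fun a => ?_
    have h := invPoch_sub_one hq ((a + 1 : ℕ) : ℤ)
    rw [zpow_natCast, show ((a + 1 : ℕ) : ℤ) - 1 = a by push_cast; ring] at h
    rw [h, Nat.choose_succ_succ' a 1, Nat.choose_one_right, pow_add, mul_pow, mul_pow]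
    ring
  rw [h1.tsum_sub h2] at h3
  linear_combination h3

/-- Euler's expansion of `(-z; q)_∞` in powers of `z`. -/
theorem hasSum_euler {q : ℂ} (hq : ‖q‖ < 1) (z : ℂ) :
    HasSum (fun a : ℕ => q ^ a.choose 2 * z ^ a * invPoch q a) (qPochInf (-z) q) := by
  have hiter : ∀ n : ℕ, ∑' a : ℕ, q ^ a.choose 2 * z ^ a * invPoch q a =
      qPoch (-z) q n * ∑' a : ℕ, q ^ a.choose 2 * (z * q ^ n) ^ a * invPoch q a := by
    intro n
    induction n with
    | zero => simp [qPoch]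
    | succ n ih =>
      rw [ih, tsum_eulerTerm_eq hq (z * q ^ n), qPoch_succ, pow_succ q n, ← mul_assoc z]
      ring
  have hlim : Tendsto
      (fun n : ℕ => ∑' a : ℕ, q ^ a.choose 2 * (z * q ^ n) ^ a * invPoch q a) atTop
      (𝓝 (∑' a : ℕ, if a = 0 then 1 else 0)) := by
    refine tendsto_tsum_of_dominated_convergence (summable_norm_eulerTerm hq z) ?_ ?_
    · rintro (_ | a)
      · simp [invPoch_zero]
      · have h : Tendsto (fun n : ℕ => z * q ^ n) atTop (𝓝 0) := by
          simpa using (tendsto_pow_atTop_nhds_zero_of_norm_lt_one hq).const_mul z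
        have h' := ((h.pow (a + 1)).const_mul (q ^ (a + 1).choose 2)).mul_const
          (invPoch q ((a + 1 : ℕ) : ℤ))
        simpa using h'
    · refine Eventually.of_forall fun n a => ?_
      rw [norm_mul, norm_mul, norm_mul, norm_mul, norm_pow (z * q ^ n), norm_pow z]
      gcongr
      rw [norm_mul, norm_pow]
      exact mul_le_of_le_one_right (norm_nonneg z) (pow_le_one₀ (norm_nonneg q) hq.le)
  rw [tsum_ite_eq] at hlim
  have h := (tendsto_qPoch (-z) hq).mul hlim
  have h' := tendsto_nhds_unique (tendsto_const_nhds.congr hiter) h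
  rw [mul_one] at h'
  rw [← h']
  exact (summable_norm_eulerTerm hq z).of_norm.hasSum

/-- A bilateral series `∑ q ^ e n` converges absolutely if `e n` grows at least like `|n|`. -/
lemma summable_norm_zpow_of_abs_le {q : ℂ} (hq : ‖q‖ < 1) (hq0 : q ≠ 0) {e : ℤ → ℤ} (c : ℤ)
    (he : ∀ n, |n| ≤ e n + c) : Summable fun n : ℤ => ‖q ^ e n‖ := by
  have hpos : 0 < ‖q‖ := norm_pos_iff.mpr hq0
  have hgeo := summable_geometric_of_lt_one (norm_nonneg q) hq
  have h : Summable fun n : ℤ => ‖q‖ ^ |n| := by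
    refine Summable.of_nat_of_neg ?_ ?_ <;> simpa using hgeo
  refine Summable.of_nonneg_of_le (fun n => norm_nonneg _) (fun n => ?_)
    (h.mul_left (‖q‖ ^ (-c)))
  rw [norm_zpow, ← zpow_add₀ hpos.ne']
  exact zpow_le_zpow_right_of_le_one₀ hpos hq.le (by linarith [he n])

lemma summable_durfeeTerm {q : ℂ} (hq : ‖q‖ < 1) (hq0 : q ≠ 0) (d : ℤ) :
    Summable fun b : ℤ => q ^ (b * (b + d)) * invPoch q b * invPoch q (b + d) := by
  obtain ⟨M, hM0, hM⟩ := exists_norm_invPoch_le hq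
  have h : Summable fun b : ℤ => ‖q ^ (b * (b + d))‖ := by
    refine summable_norm_zpow_of_abs_le hq hq0 ((|d| + 1) ^ 2) fun b => ?_
    nlinarith [sq_abs b, abs_mul b d, neg_abs_le (b * d), abs_nonneg b, abs_nonneg d,
      sq_nonneg (|b| - (|d| + 1)), mul_nonneg (abs_nonneg b) (abs_nonneg d)]
  refine Summable.of_norm_bounded (h.mul_right (M * M)) fun b => ?_
  rw [mul_assoc, norm_mul, norm_mul (invPoch q b)]
  gcongr
  exacts [hM _, hM _]

/-- Writing `G d` for the Durfee sum, `G d - G (d + 1) = -q ^ (d + 1) (G (d + 1) - G (d + 2))`. -/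
lemma tsum_durfeeTerm_sub {q : ℂ} (hq : ‖q‖ < 1) (hq0 : q ≠ 0) (d : ℤ) :
    ∑' b : ℤ, q ^ (b * (b + d)) * invPoch q b * invPoch q (b + d) -
      ∑' b : ℤ, q ^ (b * (b + (d + 1))) * invPoch q b * invPoch q (b + (d + 1)) =
    -q ^ (d + 1) *
      (∑' b : ℤ, q ^ (b * (b + (d + 1))) * invPoch q b * invPoch q (b + (d + 1)) -
        ∑' b : ℤ, q ^ (b * (b + (d + 2))) * invPoch q b * invPoch q (b + (d + 2))) := by
  have h0 := summable_durfeeTerm hq hq0 d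
  have h1 := summable_durfeeTerm hq hq0 (d + 1)
  have h2 := summable_durfeeTerm hq hq0 (d + 2)
  have h2' := (Equiv.subRight (1 : ℤ)).summable_iff.mpr h2
  rw [← (Equiv.subRight (1 : ℤ)).tsum_eq
    (fun b : ℤ => q ^ (b * (b + (d + 2))) * invPoch q b * invPoch q (b + (d + 2))),
    ← h0.tsum_sub h1, mul_sub, ← tsum_mul_left, ← tsum_mul_left]
  refine Eq.trans ?_ ((h1.mul_left (-q ^ (d + 1))).tsum_sub (h2'.mul_left (-q ^ (d + 1))))
  refine tsum_congr fun b => ?_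
  have e1 := invPoch_sub_one hq b
  have e2 := invPoch_sub_one hq (b + (d + 1))
  rw [show b + (d + 1) - 1 = b + d by ring] at e2
  simp only [Equiv.subRight_apply]
  rw [show b - 1 + (d + 2) = b + (d + 1) by ring, e1, e2,
    show b * (b + (d + 1)) = b * (b + d) + b by ring,
    show (b - 1) * (b + (d + 1)) = b * (b + d) - (d + 1) by ring,
    zpow_sub₀ hq0, zpow_add₀ hq0 _ b, zpow_add₀ hq0 b (d + 1)]
  have hz : q ^ (d + 1) ≠ 0 := zpow_ne_zero _ hq0
  field_simp
  ring

/-- Cauchy's sum `∑ q ^ (b (b + d)) / ((q; q)_b (q; q)_{b + d}) = 1 / (q; q)_∞`. It tends to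
`1 / (q; q)_∞` as `d → ∞`, and the recurrence of `tsum_durfeeTerm_sub` makes it constant in `d`. -/
theorem hasSum_durfee {q : ℂ} (hq : ‖q‖ < 1) (hq0 : q ≠ 0) (d : ℤ) :
    HasSum (fun b : ℤ => q ^ (b * (b + d)) * invPoch q b * invPoch q (b + d))
      (qPochInf q q)⁻¹ := by
  set G : ℤ → ℂ := fun d => ∑' b : ℤ, q ^ (b * (b + d)) * invPoch q b * invPoch q (b + d) with hG
  have hlim : Tendsto (fun n : ℕ => G n) atTop (𝓝 (qPochInf q q)⁻¹) := by
    obtain ⟨M, hM0, hM⟩ := exists_norm_invPoch_le hq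
    have hs : Summable fun b : ℤ => ‖q ^ (b * b)‖ := by
      refine summable_norm_zpow_of_abs_le hq hq0 1 fun b => ?_
      nlinarith [sq_abs b, sq_nonneg (|b| - 1), abs_nonneg b]
    have hone : (qPochInf q q)⁻¹ = ∑' b : ℤ, if b = 0 then (qPochInf q q)⁻¹ else 0 := by
      rw [tsum_ite_eq]
    rw [hone]
    refine tendsto_tsum_of_dominated_convergence (hs.mul_right (M * M)) ?_ ?_
    · intro b
      rcases lt_trichotomy b 0 with hb | rfl | hb
      · simp [invPoch_of_neg q hb, hb.ne]
      · simpa [invPoch_zero] using tendsto_invPoch hq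
      · obtain ⟨m, rfl⟩ : ∃ m : ℕ, b = ((m + 1 : ℕ) : ℤ) := ⟨(b - 1).toNat, by omega⟩
        rw [if_neg hb.ne']
        refine squeeze_zero_norm (a := fun n : ℕ => ‖q‖ ^ n * (M * M)) (fun n => ?_) ?_
        · rw [mul_assoc, norm_mul, norm_mul (invPoch q _)]
          gcongr
          · rw [← Nat.cast_add, ← Nat.cast_mul, zpow_natCast, norm_pow]
            refine pow_le_pow_of_le_one (norm_nonneg q) hq.le ?_
            nlinarith
          exacts [hM _, hM _]
        · simpa using
            (tendsto_pow_atTop_nhds_zero_of_lt_one (norm_nonneg q) hq).mul_const (M * M)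
    · refine Eventually.of_forall fun n b => ?_
      rcases lt_or_ge b 0 with hb | hb
      · simp only [invPoch_of_neg q hb, mul_zero, zero_mul, norm_zero]
        positivity
      · rw [mul_assoc, norm_mul, norm_mul (invPoch q _)]
        gcongr
        · rw [norm_zpow, norm_zpow]
          refine zpow_le_zpow_right_of_le_one₀ (norm_pos_iff.mpr hq0) hq.le ?_
          nlinarith [mul_nonneg hb (Nat.cast_nonneg (α := ℤ) n)]
        exacts [hM _, hM _]
  have hstep : ∀ n : ℕ, G n = G (n + 1 : ℕ) := by
    -- by the recurrence the norms of successive differences increase, yet they tend to zero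
    have hmono : Monotone fun n : ℕ => ‖G n - G (n + 1 : ℕ)‖ := by
      refine monotone_nat_of_le_succ fun n => ?_
      have h := tsum_durfeeTerm_sub hq hq0 n
      have h' : G n - G (n + 1 : ℕ) = -q ^ (n + 1) * (G (n + 1 : ℕ) - G (n + 1 + 1 : ℕ)) := by
        push_cast
        rw [show (n : ℤ) + 1 + 1 = n + 2 by ring]
        exact_mod_cast h
      rw [h', norm_mul, norm_neg, norm_pow]
      exact mul_le_of_le_one_left (norm_nonneg _) (pow_le_one₀ (norm_nonneg q) hq.le)
    have hzero : Tendsto (fun n : ℕ => ‖G n - G (n + 1 : ℕ)‖) atTop (𝓝 0) := by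
      simpa using (hlim.sub (hlim.comp (tendsto_add_atTop_nat 1))).norm
    intro n
    exact sub_eq_zero.mp (norm_le_zero_iff.mp (hmono.ge_of_tendsto hzero n))
  have hconst : ∀ n : ℕ, G n = (qPochInf q q)⁻¹ := by
    have h0 : ∀ n : ℕ, G n = G 0 := by
      intro n
      induction n with
      | zero => rfl
      | succ n ih => rw [← hstep, ih]
    intro n
    have h1 := tendsto_nhds_unique (tendsto_const_nhds.congr fun n => (h0 n).symm) hlim
    rw [h0, h1]
  have hval : G d = (qPochInf q q)⁻¹ := by
    obtain ⟨n, rfl | rfl⟩ := d.eq_nat_or_neg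
    · exact hconst n
    · rw [← hconst n, hG]
      simp only
      rw [← (Equiv.addRight (n : ℤ)).tsum_eq
        (fun b : ℤ => q ^ (b * (b + -(n : ℤ))) * invPoch q b * invPoch q (b + -(n : ℤ)))]
      refine tsum_congr fun b => ?_
      simp only [Equiv.coe_addRight]
      rw [show b + n + -(n : ℤ) = b by ring, mul_comm (b + (n : ℤ)) b]
      ring
  rw [← hval]
  exact (summable_durfeeTerm hq hq0 d).hasSum

/-- The generalized binomial coefficient `d (d - 1) / 2` of an integer `d`; the division is
exact. -/
def tri (d : ℤ) : ℤ := d * (d - 1) / 2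

lemma two_mul_tri (d : ℤ) : 2 * tri d = d * (d - 1) :=
  Int.mul_ediv_cancel' (even_iff_two_dvd.mp (Int.even_mul_pred_self d))

lemma tri_natCast (n : ℕ) : tri n = (n.choose 2 : ℕ) := by
  have h := two_mul_tri n
  have h' : ((n.choose 2 : ℕ) : ℚ) * 2 = n * (n - 1) := by
    rw [Nat.cast_choose_two]
    ring
  have h'' : ((n.choose 2 : ℕ) : ℤ) * 2 = n * (n - 1) := by exact_mod_cast h'
  linarith

lemma hasSum_of_eq {ι : Type*} {f g : ι → ℂ} {a : ℂ} (h : HasSum f a) (hfg : ∀ x, g x = f x) :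
    HasSum g a :=
  (funext hfg : g = f) ▸ h

lemma abs_le_tri_add_one (d : ℤ) : |d| ≤ tri d + 1 := by
  have h := two_mul_tri d
  rcases abs_cases d with ⟨h1, h2⟩ | ⟨h1, h2⟩
  · rw [h1]
    have : 0 ≤ (d - 1) * (d - 2) := by
      rcases le_or_gt d 1 with h3 | h3
      · nlinarith
      · exact mul_nonneg (by omega) (by omega)
    nlinarith
  · rw [h1]
    nlinarith

/-- Euler's series as a series over `ℤ`; the terms of negative index vanish. -/
lemma hasSum_euler_int {q : ℂ} (hq : ‖q‖ < 1) (z : ℂ) :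
    HasSum (fun a : ℤ => q ^ tri a * z ^ a * invPoch q a) (qPochInf (-z) q) ∧
      Summable fun a : ℤ => ‖q ^ tri a * z ^ a * invPoch q a‖ := by
  have hz : ∀ a ∉ Set.range ((↑) : ℕ → ℤ), q ^ tri a * z ^ a * invPoch q a = 0 := by
    intro a ha
    have : a < 0 := by
      by_contra h
      exact ha ⟨a.toNat, Int.toNat_of_nonneg (not_lt.mp h)⟩
    rw [invPoch_of_neg q this, mul_zero]
  have hnat : ∀ a : ℕ, q ^ tri a * z ^ (a : ℤ) * invPoch q a =
      q ^ a.choose 2 * z ^ a * invPoch q a := fun a => by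
    rw [tri_natCast, zpow_natCast, zpow_natCast]
  constructor
  · exact ((Nat.cast_injective (R := ℤ)).hasSum_iff hz).mp
      (hasSum_of_eq (hasSum_euler hq z) hnat)
  · refine ((Nat.cast_injective (R := ℤ)).summable_iff fun a ha => ?_).mp
      ((summable_norm_eulerTerm hq z).congr fun a => ?_)
    · rw [hz a ha, norm_zero]
    · rw [Function.comp_apply, hnat]

/-- The Jacobi triple product. The coefficient of `z ^ d` in the product of the Euler series for
`(z; q)_∞` and `(q / z; q)_∞` is a Durfee sum. -/
theorem hasSum_jacobi {q : ℂ} (hq : ‖q‖ < 1) (hq0 : q ≠ 0) {z : ℂ} (hz : z ≠ 0) :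
    HasSum (fun d : ℤ => (-z) ^ d * q ^ tri d)
      (qPochInf z q * qPochInf (q / z) q * qPochInf q q) := by
  have h1 := hasSum_euler_int hq (-z)
  have h2 := hasSum_euler_int hq (-(q / z))
  rw [neg_neg] at h1 h2
  have hsum := summable_mul_of_summable_norm h1.2 h2.2
  have hmul := h1.1.mul h2.1 hsum
  let e : ℤ × ℤ ≃ ℤ × ℤ :=
    { toFun := fun p => (p.2 + p.1, p.2)
      invFun := fun p => (p.1 - p.2, p.2)
      left_inv := fun p => by simp
      right_inv := fun p => by simp }
  have hP := ((e.hasSum_iff).mpr hmul).prod_fiberwise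
    (g := fun d => (-z) ^ d * q ^ tri d * (qPochInf q q)⁻¹) fun d => by
      refine hasSum_of_eq ((hasSum_durfee hq hq0 d).mul_left ((-z) ^ d * q ^ tri d)) fun b => ?_
      have hz' : -z ≠ 0 := neg_ne_zero.mpr hz
      have hexp : tri (b + d) + tri b + b = tri d + b * (b + d) := by
        linarith [two_mul_tri (b + d), two_mul_tri b, two_mul_tri d]
      have hq' : q ^ tri (b + d) * q ^ tri b * q ^ b = q ^ tri d * q ^ (b * (b + d)) := by
        rw [← zpow_add₀ hq0, ← zpow_add₀ hq0, ← zpow_add₀ hq0, hexp]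
      have hzz : (-(q / z)) ^ b = q ^ b * ((-z) ^ b)⁻¹ := by
        rw [← div_neg, div_zpow, div_eq_mul_inv]
      simp only [e, Function.comp_apply, Equiv.coe_fn_mk]
      rw [hzz, zpow_add₀ hz']
      have hzb : (-z) ^ b ≠ 0 := zpow_ne_zero _ hz'
      field_simp
      linear_combination invPoch q (b + d) * invPoch q b * hq'
  have hne := qPochInf_ne_zero hq hq
  simpa [mul_assoc, hne] using hP.mul_right (qPochInf q q)

end QSeries

/-! ### A terminating alternating sum -/

namespace QSeries

open Filter Topology

/-- The alternating sum `∑ (-1) ^ r q ^ (3 r ^ 2 + c r) / ((q; q)_{a - 2 r} (q; q)_{b + 2 r})` over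
all integers `r`, of which only finitely many contribute. -/
noncomputable def altSum (q : ℂ) (c a b : ℤ) : ℂ :=
  ∑' r : ℤ, (-1) ^ r * q ^ (3 * r ^ 2 + c * r) * (invPoch q (a - 2 * r) * invPoch q (b + 2 * r))

lemma summable_altSum (q : ℂ) (c a b : ℤ) :
    Summable fun r : ℤ => (-1) ^ r * q ^ (3 * r ^ 2 + c * r) *
      (invPoch q (a - 2 * r) * invPoch q (b + 2 * r)) := by
  refine summable_of_ne_finset_zero (s := Finset.Icc (-|b|) |a|) fun r hr => ?_
  rw [Finset.mem_Icc, not_and_or, not_le, not_le] at hr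
  rcases hr with hr | hr
  · rw [invPoch_of_neg q (show b + 2 * r < 0 by linarith [le_abs_self b, abs_nonneg b])]
    simp
  · rw [invPoch_of_neg q (show a - 2 * r < 0 by linarith [le_abs_self a, abs_nonneg a])]
    simp

lemma altSum_reflect (q : ℂ) (c a b : ℤ) : altSum q c a b = altSum q (-c) b a := by
  rw [altSum, altSum, ← (Equiv.neg ℤ).tsum_eq]
  refine tsum_congr fun r => ?_
  rw [Equiv.neg_apply, zpow_neg, ← inv_zpow, inv_neg, inv_one]
  rw [show 3 * (-r) ^ 2 + c * -r = 3 * r ^ 2 + -c * r by ring, mul_neg, sub_neg_eq_add,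
    ← sub_eq_add_neg, mul_comm (invPoch q _)]

lemma altSum_shift {q : ℂ} (hq0 : q ≠ 0) (c a b : ℤ) :
    altSum q c a b = -q ^ (3 + c) * altSum q (c + 6) (a - 2) (b + 2) := by
  rw [altSum, altSum, ← (Equiv.addRight (1 : ℤ)).tsum_eq, ← tsum_mul_left]
  refine tsum_congr fun r => ?_
  rw [Equiv.coe_addRight, zpow_add₀ (by norm_num), zpow_one,
    show 3 * (r + 1) ^ 2 + c * (r + 1) = (3 + c) + (3 * r ^ 2 + (c + 6) * r) by ring,
    zpow_add₀ hq0, show a - 2 * (r + 1) = a - 2 - 2 * r by ring,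
    show b + 2 * (r + 1) = b + 2 + 2 * r by ring]
  ring

/-- The `q`-Pascal rule lowering `a` in the first term. -/
lemma altSum_pascal {q : ℂ} (hq : ‖q‖ < 1) (hq0 : q ≠ 0) (c a b : ℤ) :
    (1 - q ^ (a + b)) * altSum q c a b =
      altSum q c (a - 1) b + q ^ a * altSum q (c - 2) a (b - 1) := by
  rw [altSum, altSum, altSum, ← tsum_mul_left, ← tsum_mul_left,
    ← (summable_altSum q c (a - 1) b).tsum_add ((summable_altSum q (c - 2) a (b - 1)).mul_left _)]
  refine tsum_congr fun r => ?_
  have h1 := invPoch_sub_one hq (a - 2 * r)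
  have h2 := invPoch_sub_one hq (b + 2 * r)
  have h3 : q ^ (a + b) = q ^ (a - 2 * r) * q ^ (b + 2 * r) := by
    rw [← zpow_add₀ hq0]
    ring_nf
  have h4 : q ^ a * q ^ (3 * r ^ 2 + (c - 2) * r) = q ^ (a - 2 * r) * q ^ (3 * r ^ 2 + c * r) := by
    rw [← zpow_add₀ hq0, ← zpow_add₀ hq0]
    ring_nf
  rw [show a - 1 - 2 * r = a - 2 * r - 1 by ring, show b - 1 + 2 * r = b + 2 * r - 1 by ring,
    h1, h2, h3]
  linear_combination -(-1) ^ r * invPoch q (a - 2 * r) * (1 - q ^ (b + 2 * r)) *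
    invPoch q (b + 2 * r) * h4

/-- The `q`-Pascal rule lowering `b` in the first term. -/
lemma altSum_pascal' {q : ℂ} (hq : ‖q‖ < 1) (hq0 : q ≠ 0) (c a b : ℤ) :
    (1 - q ^ (a + b)) * altSum q c a b =
      altSum q c a (b - 1) + q ^ b * altSum q (c + 2) (a - 1) b := by
  rw [altSum_reflect, add_comm a b, altSum_pascal hq hq0, altSum_reflect q c a,
    altSum_reflect q (c + 2), show -c - 2 = -(c + 2) by ring]

/-- The substitution `r ↦ -1 - r` changes the sign of this sum. -/
lemma altSum_three_eq_zero {q : ℂ} (hq0 : q ≠ 0) (a : ℤ) : altSum q 3 a (a + 2) = 0 := by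
  have h : altSum q 3 a (a + 2) = -altSum q 3 a (a + 2) := by
    conv_lhs => rw [altSum_reflect, altSum_shift hq0]
    norm_num
  linear_combination h / 2

lemma one_sub_zpow_ne_zero {q : ℂ} (hq : ‖q‖ < 1) {n : ℤ} (hn : 0 < n) :
    1 - q ^ n ≠ 0 := by
  obtain ⟨m, rfl⟩ : ∃ m : ℕ, n = ((m + 1 : ℕ) : ℤ) := ⟨(n - 1).toNat, by omega⟩
  rw [zpow_natCast, pow_succ']
  exact one_sub_mul_pow_ne_zero hq hq m

lemma altSum_zero_one {q : ℂ} (hq : ‖q‖ < 1) (hq0 : q ≠ 0) (n : ℤ) :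
    (1 - q ^ (2 * n + 1)) * altSum q 1 n (n + 1) = altSum q 1 n n := by
  have h := altSum_pascal' hq hq0 1 n (n + 1)
  have h0 := altSum_three_eq_zero hq0 (n - 1)
  rw [show n - 1 + 2 = n + 1 by ring] at h0
  rw [show (1 : ℤ) + 2 = 3 by norm_num, h0, add_sub_cancel_right] at h
  rw [show 2 * n + 1 = n + (n + 1) by ring, h, mul_zero, add_zero]

lemma altSum_succ_succ {q : ℂ} (hq : ‖q‖ < 1) (hq0 : q ≠ 0) (n : ℤ) :
    (1 - q ^ (2 * n + 2)) * altSum q 1 (n + 1) (n + 1) =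
      (1 + q ^ (n + 1)) * altSum q 1 n (n + 1) := by
  have h := altSum_pascal hq hq0 1 (n + 1) (n + 1)
  rw [show (1 : ℤ) - 2 = -1 by norm_num, ← altSum_reflect, add_sub_cancel_right] at h
  rw [show 2 * n + 2 = n + 1 + (n + 1) by ring, h]
  ring

/-- The sums for `s = 1` and `s = 2` coincide, so the Bailey pair relative to `q` serves both. -/
lemma altSum_add_two {q : ℂ} (hq : ‖q‖ < 1) (hq0 : q ≠ 0) {n : ℤ} (hn : 0 ≤ n) :
    altSum q 1 n (n + 2) = altSum q 1 n (n + 1) := by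
  have h1 := altSum_pascal' hq hq0 1 n (n + 2)
  have h2 := altSum_pascal' hq hq0 3 (n - 1) (n + 2)
  have h0 := altSum_three_eq_zero hq0 (n - 1)
  have h3 := altSum_shift hq0 (-1) n n
  have h4 := altSum_zero_one hq hq0 n
  rw [show n - 1 + 2 = n + 1 by ring] at h0
  rw [← altSum_reflect q 1] at h3
  norm_num at h1 h2 h3
  rw [show n + 2 - 1 = n + 1 by ring] at h1 h2
  rw [show n - 1 + (n + 2) = 2 * n + 1 by ring, show n - 1 - 1 = n - 2 by ring, h0, zero_add] at h2
  rw [show n + (n + 2) = 2 * n + 2 by ring] at h1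
  have e2 : q ^ (n + 2) = q ^ n * q ^ 2 := by
    rw [zpow_add₀ hq0]
    norm_cast
  have e3 : q ^ (2 * n + 2) = q ^ n * q ^ (n + 2) := by
    rw [← zpow_add₀ hq0]
    ring_nf
  -- the middle sum of the Pascal rule is itself a multiple of the target
  have h5 : altSum q 3 (n - 1) (n + 2) = -q ^ n * altSum q 1 n (n + 1) := by
    refine mul_left_cancel₀ (one_sub_zpow_ne_zero hq (show 0 < 2 * n + 1 by omega)) ?_
    rw [h2, e2]
    linear_combination q ^ n * h4 + q ^ n * h3
  refine mul_left_cancel₀ (one_sub_zpow_ne_zero hq (show 0 < 2 * n + 2 by omega)) ?_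
  rw [h1, h5, e3]
  ring

lemma altSum_zero_zero (q : ℂ) : altSum q 1 0 0 = 1 := by
  rw [altSum, tsum_eq_single 0]
  · simp [invPoch_zero]
  · intro r hr
    rcases lt_or_gt_of_ne hr with h | h
    · rw [invPoch_of_neg q (show 0 + 2 * r < 0 by omega)]
      simp
    · rw [invPoch_of_neg q (show 0 - 2 * r < 0 by omega)]
      simp

/-- The Bailey pair relative to `1`. -/
lemma altSum_self {q : ℂ} (hq : ‖q‖ < 1) (hq0 : q ≠ 0) (n : ℕ) :
    altSum q 1 n n = qPoch (-q) q n * invPoch q (2 * n) := by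
  induction n with
  | zero => simp [altSum_zero_zero, qPoch, invPoch_zero]
  | succ n ih =>
    have h1 := altSum_zero_one hq hq0 n
    have h2 := altSum_succ_succ hq hq0 n
    have e1 := invPoch_sub_one hq (2 * n + 1)
    have e2 := invPoch_sub_one hq (2 * n + 2)
    rw [add_sub_cancel_right] at e1
    rw [show (2 * n + 2 : ℤ) - 1 = 2 * n + 1 by ring] at e2
    push_cast
    rw [show 2 * ((n : ℤ) + 1) = 2 * n + 2 by ring, qPoch_succ]
    have e3 : q ^ ((n : ℤ) + 1) = q * q ^ n := by
      rw [zpow_add₀ hq0, zpow_one, zpow_natCast, mul_comm]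
    refine mul_left_cancel₀ (one_sub_zpow_ne_zero hq (show 0 < 2 * (n : ℤ) + 2 by omega)) ?_
    refine mul_left_cancel₀ (one_sub_zpow_ne_zero hq (show 0 < 2 * (n : ℤ) + 1 by omega)) ?_
    rw [h2, e3]
    linear_combination (1 + q * q ^ n) * h1 + (1 + q * q ^ n) * ih +
      qPoch (-q) q n * (1 + q * q ^ n) * (e1 + (1 - q ^ (2 * (n : ℤ) + 1)) * e2)

/-- The Bailey pair relative to `q`. -/
lemma altSum_add_one {q : ℂ} (hq : ‖q‖ < 1) (hq0 : q ≠ 0) (n : ℕ) :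
    altSum q 1 n (n + 1) = qPoch (-q) q n * invPoch q (2 * n + 1) := by
  have h1 := altSum_zero_one hq hq0 n
  have e1 := invPoch_sub_one hq (2 * n + 1)
  rw [add_sub_cancel_right] at e1
  refine mul_left_cancel₀ (one_sub_zpow_ne_zero hq (show 0 < 2 * (n : ℤ) + 1 by omega)) ?_
  linear_combination h1 + altSum_self hq hq0 n + qPoch (-q) q n * e1

end QSeries

/-! ### Rogers' identities modulo 14 -/

namespace QSeries

open Filter Topology

/-- The bilateral theta series produced by the Bailey pairs, as a product. -/
lemma hasSum_theta {q : ℂ} (hq : ‖q‖ < 1) (hq0 : q ≠ 0) (s : ℕ) :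
    HasSum (fun r : ℤ => (-1) ^ r * q ^ (7 * r ^ 2 + (2 * s + 1) * r))
      (qPochInf (q ^ (8 + 2 * s)) (q ^ 14) * qPochInf (q ^ 14 / q ^ (8 + 2 * s)) (q ^ 14) *
        qPochInf (q ^ 14) (q ^ 14)) := by
  have hq14 : ‖q ^ 14‖ < 1 := by
    rw [norm_pow]
    exact pow_lt_one₀ (norm_nonneg q) hq (by norm_num)
  refine hasSum_of_eq (hasSum_jacobi hq14 (pow_ne_zero 14 hq0) (pow_ne_zero (8 + 2 * s) hq0))
    fun r => ?_
  rw [neg_eq_neg_one_mul (q ^ _), mul_zpow, mul_assoc, ← zpow_natCast q (8 + 2 * s),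
    ← zpow_natCast q 14, ← zpow_mul, ← zpow_mul, ← zpow_add₀ hq0]
  congr 2
  push_cast
  linear_combination -7 * two_mul_tri r

/-- The weak Bailey lemma: summing the Durfee sums against `altSum`. -/
lemma hasSum_bailey {q : ℂ} (hq : ‖q‖ < 1) (hq0 : q ≠ 0) {s : ℕ} (hs : s ≤ 2) {θ : ℂ}
    (hθ : HasSum (fun r : ℤ => (-1) ^ r * q ^ (7 * r ^ 2 + (2 * s + 1) * r)) θ) :
    HasSum (fun n : ℕ => q ^ (n ^ 2 + s * n) * altSum q 1 n (n + s)) (θ * (qPochInf q q)⁻¹) := by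
  set f : ℤ → ℤ → ℂ := fun r n => (-1) ^ r * q ^ (3 * r ^ 2 + 1 * r) * q ^ (n ^ 2 + s * n) *
    (invPoch q (n - 2 * r) * invPoch q (n + s + 2 * r)) with hf
  have hsum : Summable fun p : ℤ × ℤ => f p.1 p.2 := by
    obtain ⟨M, hM0, hM⟩ := exists_norm_invPoch_le hq
    have h1 : Summable fun r : ℤ => ‖q ^ (3 * r ^ 2 + 1 * r)‖ := by
      refine summable_norm_zpow_of_abs_le hq hq0 1 fun r => ?_
      nlinarith [sq_abs r, neg_abs_le r, sq_nonneg (|r| - 1)]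
    have h2 : Summable fun n : ℤ => ‖q ^ (n ^ 2 + s * n)‖ := by
      refine summable_norm_zpow_of_abs_le hq hq0 (((s : ℤ) + 1) ^ 2) fun n => ?_
      nlinarith [sq_abs n, neg_abs_le n, sq_nonneg (|n| - (s + 1)), abs_nonneg n,
        mul_nonneg (Nat.cast_nonneg (α := ℤ) s) (abs_nonneg n),
        mul_le_mul_of_nonneg_left (neg_abs_le n) (Nat.cast_nonneg (α := ℤ) s)]
    have h3 := (h1.mul_of_nonneg h2 (fun _ => norm_nonneg _) fun _ => norm_nonneg _).mul_right
      (M * M)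
    refine Summable.of_norm_bounded h3 fun p => ?_
    simp only [hf, norm_mul, norm_zpow (-1 : ℂ), norm_neg, norm_one, one_zpow, one_mul]
    gcongr
    exacts [hM _, hM _]
  have hrow : ∀ r : ℤ, HasSum (f r)
      ((-1) ^ r * q ^ (7 * r ^ 2 + (2 * s + 1) * r) * (qPochInf q q)⁻¹) := by
    intro r
    have h := ((Equiv.subRight (2 * r)).hasSum_iff.mpr (hasSum_durfee hq hq0 (4 * r + s))).mul_left
      ((-1) ^ r * q ^ (7 * r ^ 2 + (2 * s + 1) * r))
    refine hasSum_of_eq h fun n => ?_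
    -- row `r` is the Durfee sum with index `n - 2 r` and difference `4 r + s`
    have hexp : q ^ (3 * r ^ 2 + 1 * r) * q ^ (n ^ 2 + s * n) =
        q ^ (7 * r ^ 2 + (2 * s + 1) * r) * q ^ ((n - 2 * r) * (n - 2 * r + (4 * r + s))) := by
      rw [← zpow_add₀ hq0, ← zpow_add₀ hq0]
      ring_nf
    simp only [hf, Function.comp_apply, Equiv.subRight_apply]
    rw [mul_assoc ((-1 : ℂ) ^ r), hexp, show n - 2 * r + (4 * r + s) = n + s + 2 * r by ring]
    ring
  have hcol : ∀ n : ℤ, HasSum (fun r => f r n) (q ^ (n ^ 2 + s * n) * altSum q 1 n (n + s)) := by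
    intro n
    refine hasSum_of_eq ((summable_altSum q 1 n (n + s)).hasSum.mul_left (q ^ (n ^ 2 + s * n)))
      fun r => ?_
    simp only [hf]
    ring
  have htot : HasSum (fun p : ℤ × ℤ => f p.1 p.2) (θ * (qPochInf q q)⁻¹) := by
    have h := hsum.hasSum.prod_fiberwise hrow
    rw [← h.unique (hθ.mul_right _)]
    exact hsum.hasSum
  have hswap := ((Equiv.prodComm ℤ ℤ).hasSum_iff.mpr htot).prod_fiberwise hcol
  -- for `n < 0` and `s ≤ 2` no integer `r` satisfies `2 r ≤ n` and `-(n + s) ≤ 2 r`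
  have hneg : ∀ n ∉ Set.range ((↑) : ℕ → ℤ), q ^ (n ^ 2 + s * n) * altSum q 1 n (n + s) = 0 := by
    intro n hn
    have hn0 : n < 0 := by
      by_contra h
      exact hn ⟨n.toNat, Int.toNat_of_nonneg (not_lt.mp h)⟩
    rw [← (hcol n).tsum_eq]
    refine (tsum_congr fun r => ?_).trans tsum_zero
    simp only [hf]
    by_cases hr : n - 2 * r < 0
    · rw [invPoch_of_neg q hr]
      ring
    · rw [invPoch_of_neg q (show n + s + 2 * r < 0 by omega)]
      ring
  refine hasSum_of_eq (((Nat.cast_injective (R := ℤ)).hasSum_iff hneg).mpr hswap) fun n => ?_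
  simp only [Function.comp_apply]
  rw [← zpow_natCast q]
  push_cast
  rfl

/-! ### Double series reduced to single series -/

lemma tri_sub (J i : ℤ) : tri (J - i) = tri (i + 1) + tri J + -i * J := by
  linarith [two_mul_tri (J - i), two_mul_tri (i + 1), two_mul_tri J]

lemma qPochInf_zpow_neg_eq_zero {q : ℂ} (hq : ‖q‖ < 1) (hq0 : q ≠ 0) (i : ℕ) :
    qPochInf (q ^ (-(i : ℤ))) q = 0 := by
  induction i with
  | zero => rw [qPochInf_eq_one_sub_mul _ hq]; simp
  | succ i ih =>
    rw [qPochInf_eq_one_sub_mul _ hq, ← zpow_add_one₀ hq0,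
      show -((i + 1 : ℕ) : ℤ) + 1 = -(i : ℤ) by push_cast; ring, ih, mul_zero]

lemma qPochInf_neg_zpow_neg {q : ℂ} (hq : ‖q‖ < 1) (hq0 : q ≠ 0) (i : ℕ) :
    q ^ tri (i + 1) * qPochInf (-q ^ (-(i : ℤ))) q = 2 * (qPoch (-q) q i * qPochInf (-q) q) := by
  induction i with
  | zero =>
    rw [qPochInf_eq_one_sub_mul _ hq]
    simp [tri, qPoch]
    norm_num
  | succ i ih =>
    have hexp : tri (((i + 1 : ℕ) : ℤ) + 1) = tri ((i : ℤ) + 1) + (i + 1 : ℕ) := by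
      push_cast
      linarith [two_mul_tri ((i : ℤ) + 1 + 1), two_mul_tri ((i : ℤ) + 1)]
    rw [qPochInf_eq_one_sub_mul _ hq, neg_mul, ← zpow_add_one₀ hq0,
      show -((i + 1 : ℕ) : ℤ) + 1 = -(i : ℤ) by push_cast; ring, hexp, zpow_add₀ hq0, zpow_neg,
      qPoch_succ, zpow_natCast]
    have hp : q ^ (i + 1) ≠ 0 := pow_ne_zero _ hq0
    have e : q ^ (i + 1) * (1 - -(q ^ (i + 1))⁻¹) = 1 - -q * q ^ i := by
      field_simp
      ring
    linear_combination q ^ tri ((i : ℤ) + 1) * qPochInf (-q ^ (-(i : ℤ))) q * e +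
      (1 - -q * q ^ i) * ih

lemma hasSum_even_odd_of_alternating {t : ℕ → ℂ} {S : ℂ} (h : HasSum t (2 * S))
    (h' : HasSum (fun J => (-1) ^ J * t J) 0) {ε : ℕ} (hε : ε < 2) :
    HasSum (fun j => t (2 * j + ε)) S := by
  have he : Summable fun j => t (2 * j) :=
    h.summable.comp_injective fun a b hab => by simpa using hab
  have ho : Summable fun j => t (2 * j + 1) :=
    h.summable.comp_injective fun a b hab => by simpa using hab
  have h1 := (he.hasSum.even_add_odd ho.hasSum).unique h
  have h2 : ∑' j, t (2 * j) + -∑' j, t (2 * j + 1) = 0 := by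
    refine HasSum.unique (HasSum.even_add_odd ?_ ?_) h'
    · simpa using he.hasSum
    · simpa [pow_succ] using ho.hasSum.neg
  have hE : ∑' j, t (2 * j) = S := by linear_combination (h1 + h2) / 2
  have hO : ∑' j, t (2 * j + 1) = S := by linear_combination (h1 - h2) / 2
  interval_cases ε
  · exact hE ▸ he.hasSum
  · exact hO ▸ ho.hasSum

/-- The even and the odd part of Euler's series at `z = q ^ (-i)` agree, because the series
vanishes at `z = -q ^ (-i)`. -/
lemma hasSum_inner {q : ℂ} (hq : ‖q‖ < 1) (hq0 : q ≠ 0) (i : ℕ) {ε : ℕ} (hε : ε < 2) :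
    HasSum (fun j : ℕ => q ^ tri (((2 * j + ε : ℕ) : ℤ) - i) * invPoch q (2 * j + ε : ℕ))
      (qPoch (-q) q i * qPochInf (-q) q) := by
  have key : ∀ J : ℕ, q ^ tri ((J : ℤ) - i) * invPoch q J =
      q ^ tri ((i : ℤ) + 1) * (q ^ J.choose 2 * (q ^ (-(i : ℤ))) ^ J * invPoch q J) := by
    intro J
    rw [tri_sub, zpow_add₀ hq0, zpow_add₀ hq0, tri_natCast, zpow_natCast, zpow_mul, zpow_natCast]
    ring
  refine hasSum_even_odd_of_alternating (t := fun J : ℕ => q ^ tri ((J : ℤ) - i) * invPoch q J)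
    ?_ ?_ hε
  · rw [← qPochInf_neg_zpow_neg hq hq0]
    exact hasSum_of_eq ((hasSum_euler hq (q ^ (-(i : ℤ)))).mul_left _) key
  · have h := (hasSum_euler hq (-q ^ (-(i : ℤ)))).mul_left (q ^ tri ((i : ℤ) + 1))
    rw [neg_neg, qPochInf_zpow_neg_eq_zero hq hq0, mul_zero] at h
    refine hasSum_of_eq h fun J => ?_
    rw [key, neg_pow]
    ring

lemma hasSum_double {q : ℂ} (hq : ‖q‖ < 1) (hq0 : q ≠ 0) (s δ : ℕ) {ε : ℕ} (hε : ε < 2) {S : ℂ}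
    (hS : HasSum (fun n : ℕ => q ^ (n ^ 2 + s * n) *
      (qPoch (-q) q n * invPoch q (2 * n + δ))) S) :
    HasSum (fun p : ℕ × ℕ => q ^ ((p.1 : ℤ) ^ 2 + s * p.1 + tri (2 * p.2 + ε - p.1)) *
      (invPoch q (2 * p.1 + δ) * invPoch q (2 * p.2 + ε))) (S * qPochInf (-q) q) := by
  have hsplit : ∀ i j : ℕ, q ^ ((i : ℤ) ^ 2 + s * i + tri (2 * j + ε - i)) *
      (invPoch q (2 * i + δ) * invPoch q (2 * j + ε)) =
      q ^ (i ^ 2 + s * i) * invPoch q (2 * i + δ) *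
        (q ^ tri (((2 * j + ε : ℕ) : ℤ) - i) * invPoch q (2 * j + ε : ℕ)) := by
    intro i j
    rw [zpow_add₀ hq0, ← zpow_natCast q (i ^ 2 + s * i)]
    push_cast
    ring
  have hsum : Summable fun p : ℕ × ℕ =>
      q ^ ((p.1 : ℤ) ^ 2 + s * p.1 + tri (2 * p.2 + ε - p.1)) *
      (invPoch q (2 * p.1 + δ) * invPoch q (2 * p.2 + ε)) := by
    obtain ⟨M, hM0, hM⟩ := exists_norm_invPoch_le hq
    have h1 : Summable fun i : ℕ => ‖q‖ ^ i := summable_geometric_of_lt_one (norm_nonneg q) hq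
    have h2 : Summable fun d : ℤ => ‖q ^ tri d‖ :=
      summable_norm_zpow_of_abs_le hq hq0 1 abs_le_tri_add_one
    have h3 := (h1.mul_of_nonneg h2 (fun _ => by positivity) fun _ => norm_nonneg _).mul_right
      (M * M)
    have hinj : Function.Injective fun p : ℕ × ℕ =>
        ((p.1, 2 * (p.2 : ℤ) + ε - p.1) : ℕ × ℤ) := by
      rintro ⟨a, b⟩ ⟨c, d⟩ h
      simp only [Prod.mk.injEq] at h ⊢
      omega
    refine Summable.of_norm_bounded (h3.comp_injective hinj) fun p => ?_
    simp only [Function.comp_apply]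
    rw [norm_mul, zpow_add₀ hq0, norm_mul, norm_mul (invPoch q _)]
    gcongr
    · rw [norm_zpow, ← zpow_natCast ‖q‖]
      refine zpow_le_zpow_right_of_le_one₀ (norm_pos_iff.mpr hq0) hq.le ?_
      have h4 : (p.1 : ℤ) ≤ (p.1 : ℤ) ^ 2 := by exact_mod_cast Nat.le_self_pow two_ne_zero p.1
      have h5 : 0 ≤ (s : ℤ) * p.1 := by positivity
      linarith
    exacts [hM _, hM _]
  have h := hsum.hasSum.prod_fiberwise fun i =>
    hasSum_of_eq ((hasSum_inner hq hq0 i hε).mul_left (q ^ (i ^ 2 + s * i) * invPoch q (2 * i + δ)))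
      (hsplit i)
  have h' : HasSum (fun i : ℕ => q ^ (i ^ 2 + s * i) * invPoch q (2 * i + δ) *
      (qPoch (-q) q i * qPochInf (-q) q)) (S * qPochInf (-q) q) :=
    hasSum_of_eq (hS.mul_right _) fun i => by ring
  rw [← h.unique h']
  exact hsum.hasSum

/-- The common form of the six identities, before the infinite products are simplified. -/
lemma hasSum_double_eq {q : ℂ} (hq : ‖q‖ < 1) (hq0 : q ≠ 0) {s δ ε : ℕ}
    (hsδ : s = 0 ∧ δ = 0 ∨ s = 1 ∧ δ = 1 ∨ s = 2 ∧ δ = 1) (hε : ε < 2) :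
    HasSum (fun p : ℕ × ℕ => q ^ ((p.1 : ℤ) ^ 2 + s * p.1 + tri (2 * p.2 + ε - p.1)) *
      (invPoch q (2 * p.1 + δ) * invPoch q (2 * p.2 + ε)))
      (qPochInf (q ^ (8 + 2 * s)) (q ^ 14) * qPochInf (q ^ 14 / q ^ (8 + 2 * s)) (q ^ 14) *
        qPochInf (q ^ 14) (q ^ 14) * (qPochInf q q)⁻¹ * qPochInf (-q) q) := by
  refine hasSum_double hq hq0 s δ hε ?_
  refine hasSum_of_eq (hasSum_bailey hq hq0 (by omega) (hasSum_theta hq hq0 s)) fun n => ?_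
  congr 1
  rcases hsδ with ⟨rfl, rfl⟩ | ⟨rfl, rfl⟩ | ⟨rfl, rfl⟩
  · simpa using (altSum_self hq hq0 n).symm
  · simpa using (altSum_add_one hq hq0 n).symm
  · simpa [altSum_add_two hq hq0 (Nat.cast_nonneg n)] using (altSum_add_one hq hq0 n).symm

end QSeries

/-! ### The six double series -/

namespace QSeries

lemma qPochInf_self_eq {q : ℂ} (hq : ‖q‖ < 1) :
    qPochInf q q = qPochInf q (q ^ 2) *
      (qPochInf (q ^ 2) (q ^ 14) * qPochInf (q ^ 4) (q ^ 14) * qPochInf (q ^ 6) (q ^ 14) *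
        qPochInf (q ^ 8) (q ^ 14) * qPochInf (q ^ 10) (q ^ 14) * qPochInf (q ^ 12) (q ^ 14) *
        qPochInf (q ^ 14) (q ^ 14)) := by
  have hq2 : ‖q ^ 2‖ < 1 := by
    rw [norm_pow]
    exact pow_lt_one₀ (norm_nonneg q) hq two_ne_zero
  rw [qPochInf_eq_prod_residues q hq two_ne_zero, Finset.prod_range_succ, Finset.prod_range_one,
    pow_zero, mul_one, pow_one, ← pow_two,
    qPochInf_eq_prod_residues (q ^ 2) hq2 (show 7 ≠ 0 by norm_num)]
  simp only [Finset.prod_range_succ, Finset.prod_range_zero, one_mul, ← pow_mul, ← pow_add,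
    Nat.reduceMul, Nat.reduceAdd, mul_one]

/-- Cancelling three theta factors `e f g` of `h = (q; q)_∞` against the numerator, where
`x = (q; q²)_∞` and `y = (-q; q)_∞`. -/
lemma theta_quotient_eq {x y a b c d e f g h : ℂ} (hxy : x * y = 1) (ha : a ≠ 0) (hb : b ≠ 0)
    (hc : c ≠ 0) (hd : d ≠ 0) (he : e ≠ 0) (hf : f ≠ 0) (hg : g ≠ 0)
    (hh : h = x * (a * b * c * d * e * f * g)) :
    e * f * g * h⁻¹ * y = 1 / (x ^ 2 * (a * (b * (c * d)))) := by
  have hx : x ≠ 0 := left_ne_zero_of_mul_eq_one hxy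
  rw [hh]
  field_simp
  linear_combination hxy

lemma qPoch_zero_base (n : ℕ) : qPoch 0 0 n = 1 := by simp [qPoch]

/-- At `q = 0` only the term `i = j = 0` survives, the exponent being positive elsewhere. -/
lemma hasSum_double_zero {s δ ε : ℕ} (hε : ε < 2) :
    HasSum (fun p : ℕ × ℕ => (0 : ℂ) ^ ((p.1 : ℤ) ^ 2 + s * p.1 + tri (2 * p.2 + ε - p.1)) *
      (invPoch 0 (2 * p.1 + δ) * invPoch 0 (2 * p.2 + ε))) 1 := by
  have h0 : ∀ n : ℕ, invPoch 0 n = 1 := fun n => by rw [invPoch_natCast, qPoch_zero_base, inv_one]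
  have h := hasSum_single (f := fun p : ℕ × ℕ =>
    (0 : ℂ) ^ ((p.1 : ℤ) ^ 2 + s * p.1 + tri (2 * p.2 + ε - p.1)) *
      (invPoch 0 (2 * p.1 + δ) * invPoch 0 (2 * p.2 + ε))) (0, 0) ?_
  · convert h using 1
    have ht : tri ε = 0 := by interval_cases ε <;> rfl
    simp [ht, h0]
  · rintro ⟨i, j⟩ hij
    have ht := abs_le_tri_add_one (2 * j + ε - i)
    have ht2 := two_mul_tri (2 * j + ε - i)
    have hs : (0 : ℤ) ≤ s * i := by positivity
    have hpos : (i : ℤ) ^ 2 + s * i + tri (2 * j + ε - i) ≠ 0 := by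
      rcases Nat.eq_zero_or_pos i with rfl | hi
      · have hj : 0 < j := Nat.pos_of_ne_zero fun h => hij (by rw [h])
        have := le_abs_self (2 * (j : ℤ) + ε - (0 : ℕ))
        simp only [Nat.cast_zero] at *
        nlinarith
      · have hi' : (1 : ℤ) ≤ (i : ℤ) ^ 2 := by
          have : (1 : ℤ) ≤ i := by exact_mod_cast hi
          nlinarith
        have htri : 0 ≤ tri (2 * j + ε - i) := by
          rcases eq_or_ne (2 * (j : ℤ) + ε - i) 0 with h | h
          · rw [h] at ht2 ⊢
            omega
          · linarith [Int.one_le_abs h]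
        linarith
    simp only
    rw [zero_zpow _ hpos, zero_mul]

/-- The six identities in a common form: `s` selects the infinite product, `δ` and `ε` are the
parities of the lengths of the two shifted factorials. -/
theorem hasSum_double_product {q : ℂ} (hq : ‖q‖ < 1) {s δ ε : ℕ} {L : List ℂ}
    (hL : s = 0 ∧ δ = 0 ∧ L = [q ^ 2, q ^ 4, q ^ 10, q ^ 12] ∨
      s = 1 ∧ δ = 1 ∧ L = [q ^ 2, q ^ 6, q ^ 8, q ^ 12] ∨
      s = 2 ∧ δ = 1 ∧ L = [q ^ 4, q ^ 6, q ^ 8, q ^ 10]) (hε : ε < 2) :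
    HasSum (fun p : ℕ × ℕ => q ^ ((p.1 : ℤ) ^ 2 + s * p.1 + tri (2 * p.2 + ε - p.1)) *
      (invPoch q (2 * p.1 + δ) * invPoch q (2 * p.2 + ε)))
      (1 / (qPochInf q (q ^ 2) ^ 2 * qPochInfs L (q ^ 14))) := by
  rcases eq_or_ne q 0 with rfl | hq0
  · convert hasSum_double_zero (s := s) (δ := δ) hε using 1
    rcases hL with ⟨-, -, rfl⟩ | ⟨-, -, rfl⟩ | ⟨-, -, rfl⟩ <;> simp [qPochInfs, qPochInf]
  · have hxy := qPochInf_mul_qPochInf_neg q hq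
    have hself := qPochInf_self_eq hq
    have hne : ∀ k : ℕ, k ≠ 0 → qPochInf (q ^ k) (q ^ 14) ≠ 0 := fun k hk => by
      apply qPochInf_ne_zero <;> rw [norm_pow] <;> apply pow_lt_one₀ (norm_nonneg q) hq <;> omega
    have hdiv : ∀ k l : ℕ, k + l = 14 → q ^ 14 / q ^ k = q ^ l := fun k l h => by
      rw [← h, pow_add, mul_div_cancel_left₀ _ (pow_ne_zero k hq0)]
    convert hasSum_double_eq hq hq0 (s := s) (δ := δ) (by tauto) hε using 1
    symm
    rcases hL with ⟨rfl, rfl, rfl⟩ | ⟨rfl, rfl, rfl⟩ | ⟨rfl, rfl, rfl⟩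
    on_goal 1 => rw [hdiv _ 6 rfl]
    on_goal 2 => rw [hdiv _ 4 rfl]
    on_goal 3 => rw [hdiv _ 2 rfl]
    all_goals
      simp only [qPochInfs, List.map_cons, List.map_nil, List.prod_cons, List.prod_nil, mul_one]
      refine theta_quotient_eq hxy ?_ ?_ ?_ ?_ ?_ ?_ ?_ ?_
      on_goal 8 => rw [hself]; ring
      all_goals exact hne _ (by norm_num)

/-- `N` is the numerator of an exponent, an even integer. -/
lemma double_term_eq (q : ℂ) {N e : ℤ} {m n : ℕ} {m' n' : ℤ} (hN : N = 2 * e) (hm : m' = m)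
    (hn : n' = n) :
    q ^ (N / 2) / (qPoch q q m * qPoch q q n) = q ^ e * (invPoch q m' * invPoch q n') := by
  rw [hN, Int.mul_ediv_cancel_left _ two_ne_zero, hm, hn, invPoch_natCast, invPoch_natCast,
    div_eq_mul_inv, mul_inv]

end QSeries
/-- In each exponent the numerator is an even integer, so the division by `2` in `ℤ` is exact. -/
theorem mainTheorem10 (q : ℂ) (hq : ‖q‖ < 1) :
    HasSum (fun p : ℕ × ℕ =>
        q ^ ((3 * (p.1 : ℤ) ^ 2 - 4 * p.1 * p.2 + 4 * (p.2 : ℤ) ^ 2 + p.1 - 2 * p.2) / 2) /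
          (QSeries.qPoch q q (2 * p.1) * QSeries.qPoch q q (2 * p.2)))
      (1 / (QSeries.qPochInf q (q ^ 2) ^ 2 *
        QSeries.qPochInfs [q ^ 2, q ^ 4, q ^ 10, q ^ 12] (q ^ 14))) ∧
    HasSum (fun p : ℕ × ℕ =>
        q ^ ((3 * (p.1 : ℤ) ^ 2 - 4 * p.1 * p.2 + 4 * (p.2 : ℤ) ^ 2 - p.1 + 2 * p.2) / 2) /
          (QSeries.qPoch q q (2 * p.1) * QSeries.qPoch q q (2 * p.2 + 1)))
      (1 / (QSeries.qPochInf q (q ^ 2) ^ 2 *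
        QSeries.qPochInfs [q ^ 2, q ^ 4, q ^ 10, q ^ 12] (q ^ 14))) ∧
    HasSum (fun p : ℕ × ℕ =>
        q ^ ((3 * (p.1 : ℤ) ^ 2 - 4 * p.1 * p.2 + 4 * (p.2 : ℤ) ^ 2 + 3 * p.1 - 2 * p.2) / 2) /
          (QSeries.qPoch q q (2 * p.1 + 1) * QSeries.qPoch q q (2 * p.2)))
      (1 / (QSeries.qPochInf q (q ^ 2) ^ 2 *
        QSeries.qPochInfs [q ^ 2, q ^ 6, q ^ 8, q ^ 12] (q ^ 14))) ∧
    HasSum (fun p : ℕ × ℕ =>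
        q ^ ((3 * (p.1 : ℤ) ^ 2 - 4 * p.1 * p.2 + 4 * (p.2 : ℤ) ^ 2 + p.1 + 2 * p.2) / 2) /
          (QSeries.qPoch q q (2 * p.1 + 1) * QSeries.qPoch q q (2 * p.2 + 1)))
      (1 / (QSeries.qPochInf q (q ^ 2) ^ 2 *
        QSeries.qPochInfs [q ^ 2, q ^ 6, q ^ 8, q ^ 12] (q ^ 14))) ∧
    HasSum (fun p : ℕ × ℕ =>
        q ^ ((3 * (p.1 : ℤ) ^ 2 - 4 * p.1 * p.2 + 4 * (p.2 : ℤ) ^ 2 + 5 * p.1 - 2 * p.2) / 2) /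
          (QSeries.qPoch q q (2 * p.1 + 1) * QSeries.qPoch q q (2 * p.2)))
      (1 / (QSeries.qPochInf q (q ^ 2) ^ 2 *
        QSeries.qPochInfs [q ^ 4, q ^ 6, q ^ 8, q ^ 10] (q ^ 14))) ∧
    HasSum (fun p : ℕ × ℕ =>
        q ^ ((3 * (p.1 : ℤ) ^ 2 - 4 * p.1 * p.2 + 4 * (p.2 : ℤ) ^ 2 + 3 * p.1 + 2 * p.2) / 2) /
          (QSeries.qPoch q q (2 * p.1 + 1) * QSeries.qPoch q q (2 * p.2 + 1)))
      (1 / (QSeries.qPochInf q (q ^ 2) ^ 2 *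
        QSeries.qPochInfs [q ^ 4, q ^ 6, q ^ 8, q ^ 10] (q ^ 14))) := by
  refine ⟨?_, ?_, ?_, ?_, ?_, ?_⟩
  · refine QSeries.hasSum_of_eq (QSeries.hasSum_double_product hq (s := 0) (δ := 0) (ε := 0)
      (by simp) (by norm_num)) fun p => QSeries.double_term_eq q ?_ (by simp) (by simp)
    push_cast
    linear_combination -QSeries.two_mul_tri (2 * p.2 + 0 - p.1)
  · refine QSeries.hasSum_of_eq (QSeries.hasSum_double_product hq (s := 0) (δ := 0) (ε := 1)
      (by simp) (by norm_num)) fun p => QSeries.double_term_eq q ?_ (by simp) (by simp)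
    push_cast
    linear_combination -QSeries.two_mul_tri (2 * p.2 + 1 - p.1)
  · refine QSeries.hasSum_of_eq (QSeries.hasSum_double_product hq (s := 1) (δ := 1) (ε := 0)
      (by simp) (by norm_num)) fun p => QSeries.double_term_eq q ?_ (by simp) (by simp)
    push_cast
    linear_combination -QSeries.two_mul_tri (2 * p.2 + 0 - p.1)
  · refine QSeries.hasSum_of_eq (QSeries.hasSum_double_product hq (s := 1) (δ := 1) (ε := 1)
      (by simp) (by norm_num)) fun p => QSeries.double_term_eq q ?_ (by simp) (by simp)
    push_cast
    linear_combination -QSeries.two_mul_tri (2 * p.2 + 1 - p.1)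
  · refine QSeries.hasSum_of_eq (QSeries.hasSum_double_product hq (s := 2) (δ := 1) (ε := 0)
      (by simp) (by norm_num)) fun p => QSeries.double_term_eq q ?_ (by simp) (by simp)
    push_cast
    linear_combination -QSeries.two_mul_tri (2 * p.2 + 0 - p.1)
  · refine QSeries.hasSum_of_eq (QSeries.hasSum_double_product hq (s := 2) (δ := 1) (ε := 1)
      (by simp) (by norm_num)) fun p => QSeries.double_term_eq q ?_ (by simp) (by simp)
    push_cast
    linear_combination -QSeries.two_mul_tri (2 * p.2 + 1 - p.1)
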